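/- Graphs are finite and undirected. A graph is called series-parallel if it has no $K_4$ minor. In the $k$-cops and robber game on a graph $G$ ($k\ge 1$), $k$ cops choose (not necessarily distinct) initial vertices, and then the robber chooses his. Afterwards, starting with the cops, the cops and the robber move alternately, where in a move every cop (respectively the robber) either stays where he is or slides along an edge; all players have complete information. The cops win as soon as a cop and the robber are on the same vertex; the robber wins if this never happens. $G$ is $k$-copwin if the cops have a winning strategy, and the cop number of $G$ is the smallest $k\ge 1$ such that $G$ is $k$-copwin. For $X\subseteq V(G)$ with $|X|\le k$, the $k$-cops and robber game on $G$ with set of exits $X$ differs in the following: initially, one cop is placed on each vertex of $X$, and the robber places the remaining $k-|X|$ cops and himself on arbitrary vertices; the robber also wins if, after a move of the cops, he stands on a vertex of $X$ on which there is no cop. $G$ is $X$-exit $k$-copwin if the cops have a winning strategy in this game. **Theorem.** Every connected series-parallel graph is $\{x\}$-exit $2$-copwin for each of its vertices $x$. Consequently, every connected series-parallel graph is $2$-copwin, that is, its cop number is at most $2$. -/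

import Mathlib

namespace CopsRobber

/-- `H` is a minor of `G`: there are pairwise disjoint connected (in particular non-empty) branch
sets in `G`, one for each vertex of `H`, such that `G` has an edge between the branch sets of any
two adjacent vertices of `H`. -/
def IsMinor {W V : Type*} (H : SimpleGraph W) (G : SimpleGraph V) : Prop :=
  ∃ B : W → Set V,
    (∀ w, (G.induce (B w)).Connected) ∧
    (∀ w w', w ≠ w' → Disjoint (B w) (B w')) ∧
    (∀ w w', H.Adj w w' → ∃ a ∈ B w, ∃ b ∈ B w', G.Adj a b)

/-- A graph is series-parallel if it has no `K₄` minor. -/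
def IsSeriesParallel {V : Type*} (G : SimpleGraph V) : Prop :=
  ¬ IsMinor (SimpleGraph.completeGraph (Fin 4)) G

/-- A single player (a cop, or the robber) passes or slides along an edge. -/
def Step {V : Type*} (G : SimpleGraph V) (a b : V) : Prop :=
  a = b ∨ G.Adj a b

/-- The positions of `k` cops and of the robber. -/
structure Position (V : Type*) (k : ℕ) where
  /-- the vertices occupied by the cops -/
  cops : Fin k → V
  /-- the vertex occupied by the robber -/
  robber : V

/-- A strategy of `k` cops. Given the list of the positions at the beginning of all earlier rounds
(oldest first), and the position at the beginning of the current round, it tells every cop where to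
move; each cop passes or moves along an edge. -/
structure Strategy {V : Type*} (G : SimpleGraph V) (k : ℕ) where
  /-- the new vertices of the cops -/
  move : List (Position V k) → Position V k → Fin k → V
  /-- the moves follow the rules of the game -/
  legal : ∀ past p i, Step G (p.cops i) (move past p i)

/-- The sequence `p` is a play in which the cops follow the strategy `σ`. Here `p t` is the position
at the beginning of round `t`, before the move of the cops; in round `t`, first all cops move
from `(p t).cops` to `(p (t + 1)).cops`, and then the robber moves from `(p t).robber` to
`(p (t + 1)).robber`. (Plays are continued formally after the game has ended.) -/
def IsPlay {V : Type*} {G : SimpleGraph V} {k : ℕ} (σ : Strategy G k)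
    (p : ℕ → Position V k) : Prop :=
  ∀ t, (p (t + 1)).cops = σ.move ((List.range t).map p) (p t) ∧
    Step G (p t).robber (p (t + 1)).robber

/-- The robber is caught in round `t`: a cop is on the vertex of the robber at the beginning of
the round, or after the move of the cops in that round. -/
def CaughtAt {V : Type*} {k : ℕ} (p : ℕ → Position V k) (t : ℕ) : Prop :=
  (∃ i, (p t).cops i = (p t).robber) ∨ (∃ i, (p (t + 1)).cops i = (p t).robber)

/-- The robber stands alone on an exit vertex after the move of the cops in round `t`. -/
def EscapesAt {V : Type*} {k : ℕ} (X : Finset V) (p : ℕ → Position V k) (t : ℕ) : Prop :=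
  (p t).robber ∈ X ∧ ∀ i, (p (t + 1)).cops i ≠ (p t).robber

/-- The cops win the play `p` with set of exits `X`: the robber is caught at some time, and has
not left through an exit before. -/
def CopsWin {V : Type*} {k : ℕ} (X : Finset V) (p : ℕ → Position V k) : Prop :=
  ∃ t, CaughtAt p t ∧ ∀ s < t, ¬ EscapesAt X p s

/-- `G` is `k`-copwin: the cops can choose initial vertices and a strategy which wins whatever
the robber does (including the choice of his initial vertex). -/
def Copwin {V : Type*} (G : SimpleGraph V) (k : ℕ) : Prop :=
  ∃ (c₀ : Fin k → V) (σ : Strategy G k), ∀ p : ℕ → Position V k,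
    (p 0).cops = c₀ → IsPlay σ p → CopsWin ∅ p

/-- `G` is `X`-exit `k`-copwin, where `#X ≤ k`: the cops have a strategy which wins from every
initial position in which every exit is occupied by a cop (the other cops and the robber are
placed by the robber), whatever the robber does. -/
def ExitCopwin {V : Type*} (G : SimpleGraph V) (X : Finset V) (k : ℕ) : Prop :=
  X.card ≤ k ∧ ∃ σ : Strategy G k, ∀ p : ℕ → Position V k,
    (∀ x ∈ X, ∃ i, (p 0).cops i = x) → IsPlay σ p → CopsWin X p

/-- The cop number of `G`, the smallest integer `k ≥ 1` such that `G` is `k`-copwin. -/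
noncomputable def copNumber {V : Type*} (G : SimpleGraph V) : ℕ :=
  sInf {k : ℕ | 1 ≤ k ∧ Copwin G k}

end CopsRobber

/-
One cop confines the robber to a territory: a connected set `C` of vertices whose outer boundary
has at most two vertices, joined to each other outside `C`. He does so by staying near the image of
the robber under a map that fixes the outer boundary and moves no faster than the robber. Meanwhile
the other cop walks along a shortest path through `C` between the two boundary vertices (or along an
edge into `C`, if there is only one) until he meets the shadow of the robber on it, given by the
distance from one end. From then on he guards the path, and the robber is confined to a component
of `C` minus the path. If it were attached to three vertices of the path, it would form a `K₄` minor
with three arcs of the cycle that consists of the path and a connection of its ends outside `C`.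
So the component is a smaller territory, and the first cop is free again.
-/

namespace CopsRobber

section Game

variable {V : Type*} {G : SimpleGraph V} {k : ℕ} {X : Finset V} {q : Position V k}

/-- The position `q`, with the cops to move, is won by the cops in the game with exits `X`. -/
def Wins (G : SimpleGraph V) (X : Finset V) (q : Position V k) : Prop :=
  ∃ σ : Strategy G k, ∀ p : ℕ → Position V k, p 0 = q → IsPlay σ p → CopsWin X p

instance : Nonempty (Strategy G k) :=
  ⟨⟨fun _ q => q.cops, fun _ _ _ => Or.inl rfl⟩⟩

theorem exists_strategy_forall_wins (G : SimpleGraph V) (X : Finset V) (k : ℕ) :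
    ∃ σ : Strategy G k, ∀ p : ℕ → Position V k,
      Wins G X (p 0) → IsPlay σ p → CopsWin X p := by
  have hwins : ∀ q : Position V k, Wins G X q →
      ∃ σ : Strategy G k, ∀ p : ℕ → Position V k, p 0 = q → IsPlay σ p → CopsWin X p :=
    fun _ h => h
  choose! σ hσ using hwins
  -- The history tells the cops from which position the play started.
  refine ⟨⟨fun past q => (σ (past.headD q)).move past q, fun _ _ _ => (σ _).legal _ _ _⟩,
    fun p hp hplay => hσ (p 0) hp p rfl fun t => ?_⟩
  have hhead : ((List.range t).map p).headD (p t) = p 0 := by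
    cases t <;> simp [List.range_succ_eq_map]
  simpa only [hhead] using hplay t

/-- The strategy which plays `m` in the first round and follows `σ` from then on. -/
def Strategy.prepend (m : Position V k → Fin k → V) (hm : ∀ q i, Step G (q.cops i) (m q i))
    (σ : Strategy G k) : Strategy G k where
  move
    | [], q => m q
    | _ :: past, q => σ.move past q
  legal
    | [], q, i => hm q i
    | _ :: past, q, i => σ.legal past q i

theorem IsPlay.tail {m : Position V k → Fin k → V} {hm : ∀ q i, Step G (q.cops i) (m q i)}
    {σ : Strategy G k} {p : ℕ → Position V k} (hp : IsPlay (σ.prepend m hm) p) :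
    IsPlay σ fun t => p (t + 1) := by
  intro t
  have h := hp (t + 1)
  rwa [List.range_succ_eq_map, List.map_cons, List.map_map] at h

theorem CopsWin.of_tail {p : ℕ → Position V k} (h : CopsWin X fun t => p (t + 1))
    (h₀ : ¬ EscapesAt X p 0) : CopsWin X p := by
  obtain ⟨t, ht, hesc⟩ := h
  refine ⟨t + 1, ht, fun s hs => ?_⟩
  cases s with
  | zero => exact h₀
  | succ s => exact hesc s (by omega)

theorem exists_strategy_of_legal_move {c : Fin k → V} (hc : ∀ i, Step G (q.cops i) (c i))
    (σ : Strategy G k) :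
    ∃ τ : Strategy G k, ∀ p : ℕ → Position V k, p 0 = q → IsPlay τ p →
      (p 1).cops = c ∧ IsPlay σ fun t => p (t + 1) := by
  classical
  let m : Position V k → Fin k → V := fun q' => if q' = q then c else q'.cops
  have hm : ∀ q' i, Step G (q'.cops i) (m q' i) := by
    intro q' i
    rcases eq_or_ne q' q with rfl | h
    · simpa only [m, if_true] using hc i
    · exact Or.inl (by simp only [m, if_neg h])
  refine ⟨σ.prepend m hm, fun p hp₀ hp => ⟨?_, hp.tail⟩⟩
  exact (hp 0).1.trans (if_pos hp₀)

theorem Wins.of_move {c : Fin k → V} (hc : ∀ i, Step G (q.cops i) (c i)) (hX : q.robber ∉ X)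
    (h : ∀ r, Step G q.robber r → Wins G X ⟨c, r⟩) : Wins G X q := by
  obtain ⟨σ, hσ⟩ := exists_strategy_forall_wins G X k
  obtain ⟨τ, hτ⟩ := exists_strategy_of_legal_move hc σ
  refine ⟨τ, fun p hp₀ hp => ?_⟩
  obtain ⟨hc₁, htail⟩ := hτ p hp₀ hp
  subst hp₀ hc₁
  exact (hσ _ (h _ (hp 0).2) htail).of_tail fun hesc => hX hesc.1

theorem Wins.of_step {i : Fin k} (h : Step G (q.cops i) q.robber) : Wins G X q := by
  classical
  have hc : ∀ l, Step G (q.cops l) (Function.update q.cops i q.robber l) := by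
    intro l
    rcases eq_or_ne l i with rfl | hl
    · rwa [Function.update_self]
    · exact Or.inl (Function.update_of_ne hl _ _).symm
  obtain ⟨τ, hτ⟩ := exists_strategy_of_legal_move hc (Classical.arbitrary (Strategy G k))
  refine ⟨τ, fun p hp₀ hp => ⟨0, Or.inr ⟨i, ?_⟩, by simp⟩⟩
  rw [zero_add, (hτ p hp₀ hp).1, Function.update_self, hp₀]

theorem ExitCopwin.copwin [Nonempty V] (h : ExitCopwin G X k) : Copwin G k := by
  obtain ⟨hcard, σ, hσ⟩ := h
  let c : Fin k → V := fun i => X.toList.getD i (Classical.arbitrary V)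
  have hc : ∀ x ∈ X, ∃ i, c i = x := by
    intro x hx
    obtain ⟨i, hi, rfl⟩ := List.getElem_of_mem (Finset.mem_toList.2 hx)
    exact ⟨⟨i, hi.trans_le (X.length_toList.trans_le hcard)⟩, List.getD_eq_getElem _ _ hi⟩
  refine ⟨c, σ, fun p h₀ hp => ?_⟩
  obtain ⟨t, ht, -⟩ := hσ p (h₀ ▸ hc) hp
  exact ⟨t, ht, fun _ _ hesc => Finset.notMem_empty _ hesc.1⟩

end Game

section Connectivity

variable {V : Type*} {G : SimpleGraph V} {S C P : Set V} {r u v : V}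

/-- The vertices outside `C` with a neighbour in `C`. For a robber in `C`, they are the vertices
through which he can leave `C`. -/
def outerBoundary (G : SimpleGraph V) (C : Set V) : Set V :=
  {v | v ∉ C ∧ ∃ u ∈ C, G.Adj u v}

theorem mem_or_mem_outerBoundary (hu : u ∈ C) (h : G.Adj u v) : v ∈ C ∨ v ∈ outerBoundary G C :=
  or_iff_not_imp_left.2 fun hv => ⟨hv, u, hu, h⟩

theorem outerBoundary_nonempty (hG : G.Preconnected) (hu : u ∈ C) (hv : v ∉ C) :
    (outerBoundary G C).Nonempty := by
  obtain ⟨w⟩ := hG u v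
  obtain ⟨d, -, hfst, hsnd⟩ := w.exists_boundary_dart C hu hv
  exact ⟨d.snd, hsnd, d.fst, hfst, d.adj⟩

/-- The vertex set of the connected component of `r` in the subgraph induced by `S`, as a set of
vertices of `G`; it is empty if `r ∉ S`. -/
def componentIn (G : SimpleGraph V) (S : Set V) (r : V) : Set V :=
  ⋃₀ {T | T ⊆ S ∧ r ∈ T ∧ (G.induce T).Connected}

theorem componentIn_subset : componentIn G S r ⊆ S :=
  Set.sUnion_subset fun _ hT => hT.1

theorem connected_induce_singleton (v : V) : (G.induce {v}).Connected :=
  (SimpleGraph.connected_iff _).2 ⟨SimpleGraph.Preconnected.of_subsingleton, ⟨v, rfl⟩⟩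

theorem mem_componentIn_self (hr : r ∈ S) : r ∈ componentIn G S r :=
  ⟨{r}, ⟨Set.singleton_subset_iff.2 hr, rfl, connected_induce_singleton r⟩, rfl⟩

theorem connected_componentIn (hr : r ∈ S) : (G.induce (componentIn G S r)).Connected :=
  SimpleGraph.induce_sUnion_connected_of_pairwise_not_disjoint
    ⟨{r}, Set.singleton_subset_iff.2 hr, rfl, connected_induce_singleton r⟩
    (fun hT hT' => ⟨r, hT.2.1, hT'.2.1⟩) (fun hT => hT.2.2)

theorem mem_componentIn_of_adj (hu : u ∈ componentIn G S r) (h : G.Adj u v) (hv : v ∈ S) :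
    v ∈ componentIn G S r := by
  obtain ⟨T, ⟨hTS, hrT, hT⟩, huT⟩ := hu
  refine ⟨T ∪ {u, v}, ⟨Set.union_subset hTS (Set.pair_subset (hTS huT) hv), Or.inl hrT, ?_⟩,
    Or.inr (Or.inr rfl)⟩
  exact SimpleGraph.induce_union_connected hT.preconnected
    (SimpleGraph.induce_pair_connected_of_adj h).preconnected ⟨u, huT, Or.inl rfl⟩

theorem outerBoundary_componentIn_subset : outerBoundary G (componentIn G S r) ⊆ Sᶜ :=
  fun _ ⟨hv, _, hu, h⟩ hvS => hv (mem_componentIn_of_adj hu h hvS)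

theorem outerBoundary_componentIn_diff_subset (hP : outerBoundary G C ⊆ P) :
    outerBoundary G (componentIn G (C \ P) r) ⊆ P := by
  intro v hv
  obtain ⟨-, u, hu, h⟩ := id hv
  rcases mem_or_mem_outerBoundary (componentIn_subset hu).1 h with hvC | hvC
  · by_contra hvP
    exact outerBoundary_componentIn_subset hv ⟨hvC, hvP⟩
  · exact hP hvC

theorem connected_induce_image {p : ℕ → V} {s : Set ℕ} [hs : s.OrdConnected] (hne : s.Nonempty)
    (hadj : ∀ l ∈ s, l + 1 ∈ s → G.Adj (p l) (p (l + 1))) : (G.induce (p '' s)).Connected := by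
  have hreach : ∀ m (hm : m ∈ s), ∀ n, m ≤ n → ∀ hn : n ∈ s,
      (G.induce (p '' s)).Reachable ⟨p m, m, hm, rfl⟩ ⟨p n, n, hn, rfl⟩ := by
    intro m hm n hmn
    induction n, hmn using Nat.le_induction with
    | base => exact fun _ => SimpleGraph.Reachable.refl _
    | succ n hmn ih =>
      intro hn
      have hn' : n ∈ s := hs.out hm hn ⟨hmn, n.le_succ⟩
      have hstep : (G.induce (p '' s)).Adj ⟨p n, n, hn', rfl⟩ ⟨p (n + 1), n + 1, hn, rfl⟩ :=
        hadj n hn' hn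
      exact (ih hn').trans hstep.reachable
  refine (SimpleGraph.connected_iff _).2 ⟨?_, (hne.image p).to_subtype⟩
  rintro ⟨_, m, hm, rfl⟩ ⟨_, n, hn, rfl⟩
  rcases le_total m n with hmn | hmn
  · exact hreach m hm n hmn hn
  · exact (hreach n hn m hmn hm).symm

theorem exists_geodesic {a b : V} (h : G.Reachable a b) :
    ∃ p : ℕ → V, p 0 = a ∧ p (G.dist a b) = b ∧
      (∀ i < G.dist a b, G.Adj (p i) (p (i + 1))) ∧ ∀ i ≤ G.dist a b, G.dist a (p i) = i := by
  obtain ⟨w, hw⟩ := h.exists_walk_length_eq_dist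
  rw [← hw]
  refine ⟨w.getVert, w.getVert_zero, w.getVert_length, fun i hi => w.adj_getVert_succ hi,
    fun i hi => ?_⟩
  have hfst : G.dist a (w.getVert i) ≤ i := (SimpleGraph.dist_le (w.take i)).trans (by simp)
  have hsnd : G.dist (w.getVert i) b ≤ w.length - i :=
    (SimpleGraph.dist_le (w.drop i)).trans (by simp)
  have htri := (w.take i).reachable.dist_triangle_left b
  omega

end Connectivity

section Minor

variable {V : Type*} {G : SimpleGraph V} {A B C D : Set V}

/-- `A` and `B` are disjoint and joined by an edge, as is required of the branch sets of two
adjacent vertices of a minor. -/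
def SetAdj (G : SimpleGraph V) (A B : Set V) : Prop :=
  Disjoint A B ∧ ∃ a ∈ A, ∃ b ∈ B, G.Adj a b

instance : Std.Symm (SetAdj G) :=
  ⟨fun _ _ ⟨hd, a, ha, b, hb, h⟩ => ⟨hd.symm, b, hb, a, ha, h.symm⟩⟩

theorem SetAdj.union_left (h : SetAdj G A C) (hd : Disjoint B C) : SetAdj G (A ∪ B) C := by
  obtain ⟨hd', a, ha, c, hc, hac⟩ := h
  exact ⟨Set.disjoint_union_left.2 ⟨hd', hd⟩, a, Or.inl ha, c, hc, hac⟩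

theorem setAdj_of_mem_outerBoundary {v : V} (hv : v ∈ outerBoundary G A) (hvB : v ∈ B)
    (hd : Disjoint A B) : SetAdj G A B := by
  obtain ⟨-, u, hu, h⟩ := hv
  exact ⟨hd, u, hu, v, hvB, h⟩

theorem setAdj_image {ι : Type*} {p : ι → V} {s t u : Set ι} (hinj : u.InjOn p) (hs : s ⊆ u)
    (ht : t ⊆ u) (hst : Disjoint s t) {l m : ι} (hl : l ∈ s) (hm : m ∈ t)
    (h : G.Adj (p l) (p m)) : SetAdj G (p '' s) (p '' t) :=
  ⟨hst.image hinj hs ht, p l, Set.mem_image_of_mem p hl, p m, Set.mem_image_of_mem p hm, h⟩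

theorem isMinor_completeGraph {W : Type*} (B : W → Set V) (hconn : ∀ w, (G.induce (B w)).Connected)
    (hadj : Pairwise fun w w' => SetAdj G (B w) (B w')) :
    IsMinor (SimpleGraph.completeGraph W) G :=
  ⟨B, hconn, fun _ _ hne => (hadj hne).1, fun _ _ h => (hadj h.ne).2⟩

theorem isMinor_completeGraph_four (hA : (G.induce A).Connected) (hB : (G.induce B).Connected)
    (hC : (G.induce C).Connected) (hD : (G.induce D).Connected)
    (hAB : SetAdj G A B) (hAC : SetAdj G A C) (hAD : SetAdj G A D)
    (hBC : SetAdj G B C) (hBD : SetAdj G B D) (hCD : SetAdj G C D) :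
    IsMinor (SimpleGraph.completeGraph (Fin 4)) G := by
  refine isMinor_completeGraph ![A, B, C, D] ?_ ?_
  · simp [Fin.forall_fin_succ, hA, hB, hC, hD]
  · intro w w' hne
    fin_cases w <;> fin_cases w' <;>
      first | exact absurd rfl hne | assumption | (apply symm; assumption)

/-- `a` and `b` are joined outside `C`: a connected set `O` avoiding `C` contains `a` and is
attached to `b`. Leaving `b` out of `O` makes `O` and `b` usable in two different branch sets. -/
def LinkedOutside (G : SimpleGraph V) (C : Set V) (a b : V) : Prop :=
  ∃ O : Set V, (G.induce O).Connected ∧ a ∈ O ∧ Disjoint O C ∧ SetAdj G O {b}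

theorem LinkedOutside.anti {a b : V} (h : LinkedOutside G C a b) (hD : D ⊆ C) :
    LinkedOutside G D a b := by
  obtain ⟨O, hO, haO, hOC, hOb⟩ := h
  exact ⟨O, hO, haO, hOC.mono_right hD, hOb⟩

variable {p : ℕ → V} {L i j k : ℕ}

theorem linkedOutside_path (hadj : ∀ l < L, G.Adj (p l) (p (l + 1)))
    (hinj : (Set.Iic L).InjOn p) (hD : Disjoint D (p '' Set.Iic L)) (hij : i < j) (hj : j ≤ L) :
    LinkedOutside G D (p i) (p j) := by
  have hsub : Set.Ico i j ⊆ Set.Iic L := fun n hn => hn.2.le.trans hj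
  obtain ⟨m, rfl⟩ : ∃ m, j = m + 1 := ⟨j - 1, by omega⟩
  refine ⟨p '' Set.Ico i (m + 1), connected_induce_image ⟨i, le_rfl, hij⟩
    fun n hn _ => hadj n (hn.2.trans_le hj), ⟨i, ⟨le_rfl, hij⟩, rfl⟩,
    (hD.mono_right (Set.image_mono hsub)).symm, ?_⟩
  rw [← Set.image_singleton]
  exact setAdj_image hinj hsub (Set.singleton_subset_iff.2 hj) (by simp)
    ⟨Nat.le_of_lt_succ hij, m.lt_succ_self⟩ rfl (hadj m hj)

/-- A path closed up by a link is a cycle; `A` is its arc that contains the link. -/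
theorem exists_setAdj_of_linkedOutside (hadj : ∀ l < L, G.Adj (p l) (p (l + 1)))
    (hinj : (Set.Iic L).InjOn p) (hlink : LinkedOutside G (D ∪ p '' Set.Ioo 0 L) (p 0) (p L))
    (hD : Disjoint D (p '' Set.Iic L)) (hij : i < j) (hj : j < L) :
    ∃ A, (G.induce A).Connected ∧ Disjoint D A ∧ p i ∈ A ∧
      SetAdj G A (p '' Set.Ioc i j) ∧ SetAdj G A (p '' Set.Ioc j L) := by
  obtain ⟨O, hO, h0, hOD, hOL, o, ho, _, rfl, hoL⟩ := hlink
  have hi : Set.Iic i ⊆ Set.Iic L := Set.Iic_subset_Iic.2 (hij.trans hj).le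
  have hfst : (G.induce (p '' Set.Iic i)).Connected :=
    connected_induce_image ⟨i, Set.self_mem_Iic⟩ fun l hl _ => hadj l (hl.trans_lt (hij.trans hj))
  have hOp : Disjoint O (p '' Set.Ioc 0 L) := by
    rw [← Set.Ioo_insert_right (Nat.zero_lt_of_lt hj), Set.image_insert_eq]
    exact Set.disjoint_insert_right.2
      ⟨Set.disjoint_singleton_right.1 hOL, hOD.mono_right Set.subset_union_right⟩
  have hOarc : ∀ l m, m ≤ L → Disjoint O (p '' Set.Ioc l m) := fun l m hm =>
    hOp.mono_right (Set.image_mono (Set.Ioc_subset_Ioc (Nat.zero_le l) hm))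
  refine ⟨p '' Set.Iic i ∪ O, ?_, ?_, Or.inl ⟨i, Set.self_mem_Iic, rfl⟩, ?_, ?_⟩
  · exact SimpleGraph.induce_union_connected hfst.preconnected hO.preconnected
      ⟨p 0, ⟨0, Nat.zero_le i, rfl⟩, h0⟩
  · exact Set.disjoint_union_right.2
      ⟨hD.mono_right (Set.image_mono hi), (hOD.mono_right Set.subset_union_left).symm⟩
  · refine (setAdj_image hinj hi (Set.Ioc_subset_Iic_self.trans (Set.Iic_subset_Iic.2 hj.le))
      (Set.Iic_disjoint_Ioc le_rfl) Set.self_mem_Iic ⟨i.lt_succ_self, hij⟩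
      (hadj i (hij.trans hj))).union_left (hOarc i j hj.le)
  · refine ⟨Set.disjoint_union_left.2 ⟨?_, hOarc j L le_rfl⟩, o, Or.inr ho, p L,
      ⟨L, ⟨hj, le_rfl⟩, rfl⟩, hoL⟩
    exact (Set.Iic_disjoint_Ioc hij.le).image hinj hi Set.Ioc_subset_Iic_self

theorem isMinor_of_three_attachments (hadj : ∀ l < L, G.Adj (p l) (p (l + 1)))
    (hinj : (Set.Iic L).InjOn p) (hlink : LinkedOutside G (D ∪ p '' Set.Ioo 0 L) (p 0) (p L))
    (hD : (G.induce D).Connected) (hDp : Disjoint D (p '' Set.Iic L)) (hij : i < j) (hjk : j < k)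
    (hk : k ≤ L) (hi : p i ∈ outerBoundary G D) (hj : p j ∈ outerBoundary G D)
    (hk' : p k ∈ outerBoundary G D) :
    IsMinor (SimpleGraph.completeGraph (Fin 4)) G := by
  have hjL : j < L := hjk.trans_le hk
  have hmid : Set.Ioc i j ⊆ Set.Iic L := fun l hl => hl.2.trans hjL.le
  have hlst : Set.Ioc j L ⊆ Set.Iic L := Set.Ioc_subset_Iic_self
  have hconn : ∀ s ⊆ Set.Iic L, s.OrdConnected → s.Nonempty → (G.induce (p '' s)).Connected :=
    fun s hs _ hne => connected_induce_image hne fun l _ hl => hadj l (hs hl)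
  have hattached : ∀ s ⊆ Set.Iic L, ∀ l ∈ s, p l ∈ outerBoundary G D → SetAdj G D (p '' s) :=
    fun s hs l hl h => setAdj_of_mem_outerBoundary h (Set.mem_image_of_mem p hl)
      (hDp.mono_right (Set.image_mono hs))
  obtain ⟨A, hA, hDA, hiA, hAmid, hAlst⟩ :=
    exists_setAdj_of_linkedOutside hadj hinj hlink hDp hij hjL
  exact isMinor_completeGraph_four hD hA (hconn _ hmid inferInstance ⟨j, hij, le_rfl⟩)
    (hconn _ hlst inferInstance ⟨L, hjL, le_rfl⟩) (setAdj_of_mem_outerBoundary hi hiA hDA)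
    (hattached _ hmid j ⟨hij, le_rfl⟩ hj) (hattached _ hlst k ⟨hjk, hk⟩ hk') hAmid hAlst
    (setAdj_image hinj hmid hlst (Set.Ioc_disjoint_Ioc_of_le le_rfl) ⟨hij, le_rfl⟩
      ⟨j.lt_succ_self, hjL⟩ (hadj j hjL))

end Minor

theorem exists_eq_pair_of_no_three {α : Type*} [LinearOrder α] {s : Set α} (hfin : s.Finite)
    (hne : s.Nonempty) (h : ∀ x ∈ s, ∀ y ∈ s, ∀ z ∈ s, x < y → ¬ y < z) :
    ∃ x y, x ≤ y ∧ s = {x, y} := by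
  obtain ⟨x, hx, hmin⟩ := Set.exists_min_image s id hfin hne
  obtain ⟨y, hy, hmax⟩ := Set.exists_max_image s id hfin hne
  refine ⟨x, y, hmin y hy, Set.Subset.antisymm (fun z hz => ?_) (Set.pair_subset hx hy)⟩
  rcases (hmin z hz).eq_or_lt with hxz | hxz
  · exact Or.inl hxz.symm
  · exact Or.inr ((hmax z hz).eq_of_not_lt (h x hx z hz y hy hxz))

section Territory

variable {V : Type*} {G : SimpleGraph V} {X : Finset V} {C D : Set V} {a b : V}
  {p : ℕ → V} {L : ℕ} {f : V → ℕ} {g : V → V} {k : ℕ} {i j : Fin k} {q : Position V k}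

/-- A map of the vertices which lets a cop on the image of a robber in `C` follow that image, and so
catch the robber as soon as he leaves `C`. -/
structure IsGuardMap (G : SimpleGraph V) (C : Set V) (g : V → V) : Prop where
  apply_of_mem_outerBoundary : ∀ v ∈ outerBoundary G C, g v = v
  step : ∀ u ∈ C, ∀ v, G.Adj u v → Step G (g u) (g v)

/-- The robber is in `C`, and cop `i` is at most one step away from the image of the robber
under `g`. -/
def IsGuarding (G : SimpleGraph V) (C : Set V) (g : V → V) (i : Fin k) (q : Position V k) : Prop :=
  q.robber ∈ C ∧ Step G (q.cops i) (g q.robber)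

theorem IsGuardMap.wins_of_round (hg : IsGuardMap G C g) (hX : ∀ v ∈ C, v ∉ X) (hij : i ≠ j)
    {t : V} (hq : IsGuarding G C g i q) (hj : Step G (q.cops j) t)
    (next : ∀ q' : Position V k, IsGuarding G C g i q' → Step G q.robber q'.robber →
      q'.cops j = t → Wins G X q') : Wins G X q := by
  classical
  obtain ⟨hr, hi⟩ := hq
  let c : Fin k → V := Function.update (Function.update q.cops j t) i (g q.robber)
  have hci : c i = g q.robber := Function.update_self ..
  have hcj : c j = t := (Function.update_of_ne hij.symm _ _).trans (Function.update_self ..)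
  have hc : ∀ l, Step G (q.cops l) (c l) := by
    intro l
    rcases eq_or_ne l i with rfl | hli
    · rwa [hci]
    rcases eq_or_ne l j with rfl | hlj
    · rwa [hcj]
    exact Or.inl ((Function.update_of_ne hli _ _).trans (Function.update_of_ne hlj _ _)).symm
  refine Wins.of_move hc (hX _ hr) fun r hs => ?_
  rcases hs with rfl | hadj
  · exact next _ ⟨hr, Or.inl hci⟩ (Or.inl rfl) hcj
  have hi' : Step G (c i) (g r) := hci ▸ hg.step _ hr r hadj
  rcases mem_or_mem_outerBoundary hr hadj with hrC | hrC
  · exact next _ ⟨hrC, hi'⟩ (Or.inr hadj) hcj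
  · exact Wins.of_step (i := i) (by rwa [hg.apply_of_mem_outerBoundary r hrC] at hi')

theorem IsGuardMap.wins_of_reachable (hg : IsGuardMap G C g) (hX : ∀ v ∈ C, v ∉ X) (hij : i ≠ j)
    {t : V} (hq : IsGuarding G C g i q) (ht : G.Reachable (q.cops j) t)
    (next : ∀ q' : Position V k, IsGuarding G C g i q' → q'.cops j = t → Wins G X q') :
    Wins G X q := by
  obtain ⟨w⟩ := ht
  generalize hs : q.cops j = s at w
  induction w generalizing q with
  | nil => exact next q hq hs
  | cons h _ ih =>
    exact hg.wins_of_round hX hij hq (Or.inr (hs ▸ h)) fun q' hq' _ hj' => ih hq' next hj'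

/-- A path `p 0, …, p L` in `G` together with a retraction `p ∘ f` onto it, which does not increase
the distance along the edges that meet `C`. The image of the robber under `p ∘ f` is his shadow. -/
structure IsShadowPath (G : SimpleGraph V) (C : Set V) (p : ℕ → V) (L : ℕ) (f : V → ℕ) :
    Prop where
  le : ∀ v, f v ≤ L
  adj : ∀ l < L, G.Adj (p l) (p (l + 1))
  apply_path : ∀ l ≤ L, f (p l) = l
  lipschitz : ∀ u ∈ C, ∀ v, G.Adj u v → f v ≤ f u + 1 ∧ f u ≤ f v + 1

theorem IsShadowPath.injOn (hp : IsShadowPath G C p L f) : Set.InjOn p (Set.Iic L) :=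
  fun l hl m hm h => by rw [← hp.apply_path l hl, h, hp.apply_path m hm]

theorem IsShadowPath.isGuardMap (hp : IsShadowPath G C p L f) (hD : D ⊆ C)
    (hbd : outerBoundary G D ⊆ p '' Set.Iic L) : IsGuardMap G D (p ∘ f) where
  apply_of_mem_outerBoundary v hv := by
    obtain ⟨l, hl, rfl⟩ := hbd hv
    exact congrArg p (hp.apply_path l hl)
  step u hu v huv := by
    obtain ⟨hvu, huv⟩ := hp.lipschitz u (hD hu) v huv
    have hfu := hp.le u
    have hfv := hp.le v
    obtain h | h | h : f v = f u ∨ f v = f u + 1 ∨ f u = f v + 1 := by omega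
    · exact Or.inl (congrArg p h.symm)
    · exact Or.inr (by simpa only [Function.comp_apply, h] using hp.adj (f u) (by omega))
    · exact Or.inr (by simpa only [Function.comp_apply, h] using (hp.adj (f v) (by omega)).symm)

/-- The shadow moves by at most one vertex of the path in each round, so it cannot jump over cop `j`
while he walks up the path. -/
theorem IsShadowPath.wins_of_le (hp : IsShadowPath G C p L f) (hg : IsGuardMap G C g)
    (hX : ∀ v ∈ C, v ∉ X) (hij : i ≠ j) (hq : IsGuarding G C g i q) {m : ℕ}
    (hm : m ≤ f q.robber) (hj : q.cops j = p m)
    (next : ∀ q' : Position V k, IsGuarding G C (p ∘ f) j q' → Wins G X q') : Wins G X q := by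
  have hL := hp.le q.robber
  induction hd : L - m generalizing q m with
  | zero =>
    obtain rfl : f q.robber = m := by omega
    exact next q ⟨hq.1, Or.inl hj⟩
  | succ d ih =>
    rcases hm.eq_or_lt with rfl | hlt
    · exact next q ⟨hq.1, Or.inl hj⟩
    have hadj := hp.adj m (by omega)
    refine hg.wins_of_round hX hij hq (Or.inr (hj ▸ hadj)) fun q' hq' hs hj' => ?_
    have hf : f q.robber ≤ f q'.robber + 1 := by
      rcases hs with hs | hs
      · exact hs ▸ Nat.le_succ _
      · exact (hp.lipschitz _ hq.1 _ hs).2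
    obtain hle | rfl : m + 1 ≤ f q'.robber ∨ f q'.robber = m := by omega
    · exact ih hq' hle hj' (hp.le _) (by omega)
    · exact next q' ⟨hq'.1, Or.inr (hj' ▸ hadj.symm)⟩

/-- A connected set of vertices which the robber can leave only through `a` and `b`, and whose
complement joins `a` and `b`. -/
structure IsTerritory (G : SimpleGraph V) (C : Set V) (a b : V) : Prop where
  connected : (G.induce C).Connected
  outerBoundary_eq : outerBoundary G C = {a, b}
  linked : a = b ∨ LinkedOutside G C a b

/-- A shadow path which contains the vertices through which the robber can leave `C`, and whose
removal cuts `C` into pieces that are again territories in a series-parallel graph. -/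
structure IsCrossingPath (G : SimpleGraph V) (C : Set V) (p : ℕ → V) (L : ℕ) (f : V → ℕ) : Prop
    extends IsShadowPath G C p L f where
  outerBoundary_subset : outerBoundary G C ⊆ p '' Set.Iic L
  inner_subset : p '' Set.Ioo 0 L ⊆ C
  meets : (p '' Set.Iic L ∩ C).Nonempty
  linked : L ≤ 1 ∨ LinkedOutside G C (p 0) (p L)

/-- An edge from `a` into the territory is a crossing path. -/
theorem IsTerritory.exists_isCrossingPath_of_eq (hC : IsTerritory G C a a) :
    ∃ p L f, IsCrossingPath G C p L f := by
  classical
  obtain ⟨-, y, hy, hya⟩ : a ∈ outerBoundary G C := hC.outerBoundary_eq ▸ Or.inl rfl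
  refine ⟨fun l => if l = 0 then a else y, 1, fun v => if v = a then 0 else 1, ⟨⟨?_, ?_, ?_, ?_⟩,
    ?_, ?_, ⟨y, ⟨1, Set.self_mem_Iic, if_neg one_ne_zero⟩, hy⟩, Or.inl le_rfl⟩⟩
  · intro v
    split_ifs <;> omega
  · intro l hl
    obtain rfl : l = 0 := by omega
    exact hya.symm
  · intro l hl
    obtain rfl | rfl : l = 0 ∨ l = 1 := by omega
    · exact if_pos rfl
    · exact if_neg hya.ne
  · intro u _ v _
    split_ifs <;> omega
  · rw [hC.outerBoundary_eq, Set.pair_eq_singleton, Set.singleton_subset_iff]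
    exact ⟨0, Nat.zero_le 1, rfl⟩
  · rintro _ ⟨l, hl, rfl⟩
    exact absurd hl.2 (by have := hl.1; omega)

/-- The subgraph of the edges of `G` that meet `C`, the only ones a robber in `C` can use. -/
def edgesMeeting (G : SimpleGraph V) (C : Set V) : SimpleGraph V where
  Adj u v := G.Adj u v ∧ (u ∈ C ∨ v ∈ C)
  symm := ⟨fun _ _ h => ⟨h.1.symm, h.2.symm⟩⟩
  loopless := ⟨fun _ h => h.1.ne rfl⟩

theorem reachable_edgesMeeting (hC : (G.induce C).Connected) (ha : a ∈ outerBoundary G C)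
    (hb : b ∈ outerBoundary G C) : (edgesMeeting G C).Reachable a b := by
  obtain ⟨-, u, hu, hua⟩ := ha
  obtain ⟨-, v, hv, hvb⟩ := hb
  have huv : (edgesMeeting G C).Reachable u v :=
    (hC.preconnected ⟨u, hu⟩ ⟨v, hv⟩).map
      (⟨Subtype.val, fun {x _} h => ⟨h, Or.inl x.2⟩⟩ : G.induce C →g edgesMeeting G C)
  have hau : (edgesMeeting G C).Adj a u := ⟨hua.symm, Or.inr hu⟩
  have hvb : (edgesMeeting G C).Adj v b := ⟨hvb, Or.inl hv⟩
  exact hau.reachable.trans (huv.trans hvb.reachable)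

theorem isShadowPath_of_geodesic (hadj : ∀ l < L, G.Adj (p l) (p (l + 1)))
    (hdist : ∀ l ≤ L, (edgesMeeting G C).dist a (p l) = l) :
    IsShadowPath G C p L fun v => min ((edgesMeeting G C).dist a v) L where
  le _ := min_le_right _ _
  adj := hadj
  apply_path l hl := by rw [hdist l hl, min_eq_left hl]
  lipschitz u hu v huv := by
    have hadj : (edgesMeeting G C).Adj u v := ⟨huv, Or.inl hu⟩
    have hdiff := hadj.diff_dist_adj (u := a)
    omega

theorem IsTerritory.exists_isCrossingPath_of_ne (hC : IsTerritory G C a b) (hab : a ≠ b) :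
    ∃ p L f, IsCrossingPath G C p L f := by
  have ha : a ∈ outerBoundary G C := hC.outerBoundary_eq ▸ Or.inl rfl
  have hb : b ∈ outerBoundary G C := hC.outerBoundary_eq ▸ Or.inr rfl
  obtain ⟨p, h₀, hL, hadj, hdist⟩ := exists_geodesic (reachable_edgesMeeting hC.connected ha hb)
  generalize (edgesMeeting G C).dist a b = L at hL hadj hdist
  have hp := isShadowPath_of_geodesic (fun l hl => (hadj l hl).1) hdist
  have hinner : ∀ l, 0 < l → l < L → p l ∈ C := by
    intro l hl₀ hl
    obtain ⟨hG, hlC | hlC⟩ := hadj l hl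
    · exact hlC
    refine (mem_or_mem_outerBoundary hlC hG.symm).resolve_right fun hbd => ?_
    rw [hC.outerBoundary_eq, ← h₀, ← hL] at hbd
    rcases hbd with h | h
    · exact hl₀.ne' (hp.injOn hl.le (Nat.zero_le L) h)
    · exact hl.ne (hp.injOn hl.le Set.self_mem_Iic h)
  have hL₁ : 1 < L := by
    by_contra hL₁
    obtain rfl | rfl : L = 0 ∨ L = 1 := by omega
    · exact hab (h₀.symm.trans hL)
    · obtain ⟨-, h | h⟩ := hadj 0 one_pos
      · exact ha.1 (h₀ ▸ h)
      · exact hb.1 (hL ▸ h)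
  refine ⟨p, L, _, hp, ?_, ?_, ⟨p 1, ⟨1, hL₁.le, rfl⟩, hinner 1 one_pos hL₁⟩, Or.inr ?_⟩
  · rw [hC.outerBoundary_eq]
    exact Set.pair_subset ⟨0, Nat.zero_le L, h₀⟩ ⟨L, Set.self_mem_Iic, hL⟩
  · rintro _ ⟨l, hl, rfl⟩
    exact hinner l hl.1 hl.2
  · rw [h₀, hL]
    exact hC.linked.resolve_left hab

theorem IsTerritory.exists_isCrossingPath (hC : IsTerritory G C a b) :
    ∃ p L f, IsCrossingPath G C p L f := by
  rcases eq_or_ne a b with rfl | hab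
  · exact hC.exists_isCrossingPath_of_eq
  · exact hC.exists_isCrossingPath_of_ne hab

theorem IsCrossingPath.not_three_attachments (hsp : IsSeriesParallel G)
    (hp : IsCrossingPath G C p L f) (hDC : D ⊆ C) (hD : (G.induce D).Connected)
    (hDp : Disjoint D (p '' Set.Iic L)) {l m n : ℕ} (hlm : l < m) (hmn : m < n) (hn : n ≤ L)
    (hl : p l ∈ outerBoundary G D) (hm : p m ∈ outerBoundary G D) :
    p n ∉ outerBoundary G D := by
  intro hn'
  have hlink := (hp.linked.resolve_left (by omega)).anti (Set.union_subset hDC hp.inner_subset)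
  exact hsp (isMinor_of_three_attachments hp.adj hp.injOn hlink hD hDp hlm hmn hn hl hm hn')

theorem IsCrossingPath.exists_isTerritory (hG : G.Preconnected) (hsp : IsSeriesParallel G)
    (hp : IsCrossingPath G C p L f) {r : V} (hr : r ∈ C) (hrp : r ∉ p '' Set.Iic L) :
    ∃ D ⊂ C, r ∈ D ∧ outerBoundary G D ⊆ p '' Set.Iic L ∧ ∃ a b, IsTerritory G D a b := by
  let D := componentIn G (C \ p '' Set.Iic L) r
  obtain ⟨y, hyp, hyC⟩ := hp.meets
  have hrD : r ∈ D := mem_componentIn_self ⟨hr, hrp⟩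
  have hDC : D ⊆ C := componentIn_subset.trans Set.sdiff_subset
  have hDp : Disjoint D (p '' Set.Iic L) := Set.disjoint_sdiff_left.mono_left componentIn_subset
  have hyD : y ∉ D := Set.disjoint_right.1 hDp hyp
  have hD : (G.induce D).Connected := connected_componentIn ⟨hr, hrp⟩
  have hbd : outerBoundary G D ⊆ p '' Set.Iic L :=
    outerBoundary_componentIn_diff_subset hp.outerBoundary_subset
  obtain ⟨s, hs, hs_eq⟩ := Set.subset_image_iff.1 hbd
  have hs_mem : ∀ l ∈ s, p l ∈ outerBoundary G D := fun l hl => hs_eq ▸ Set.mem_image_of_mem p hl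
  have hne : s.Nonempty := Set.image_nonempty.1 (hs_eq ▸ outerBoundary_nonempty hG hrD hyD)
  obtain ⟨l, m, hlm, rfl⟩ := exists_eq_pair_of_no_three ((Set.finite_Iic L).subset hs) hne
    fun l hl m hm n hn hlm hmn => hp.not_three_attachments hsp hDC hD hDp hlm hmn (hs hn)
      (hs_mem l hl) (hs_mem m hm) (hs_mem n hn)
  refine ⟨D, ⟨hDC, fun h => hyD (h hyC)⟩, hrD, hbd, p l, p m, hD, ?_, ?_⟩
  · rw [← hs_eq, Set.image_pair]
  · rcases hlm.eq_or_lt with rfl | hlm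
    · exact Or.inl rfl
    · exact Or.inr (linkedOutside_path hp.adj hp.injOn hDp hlm (hs (Or.inr rfl)))

theorem IsTerritory.wins [Finite V] (hG : G.Preconnected) (hsp : IsSeriesParallel G)
    (hX : ∀ v ∈ C, v ∉ X) (hC : IsTerritory G C a b) (hg : IsGuardMap G C g) (hij : i ≠ j)
    (hq : IsGuarding G C g i q) : Wins G X q := by
  induction C using WellFoundedLT.induction generalizing a b g i j q with
  | _ C ih =>
    obtain ⟨p, L, f, hp⟩ := hC.exists_isCrossingPath
    refine hg.wins_of_reachable hX hij hq (hG _ (p 0)) fun q hq hj => ?_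
    refine hp.wins_of_le hg hX hij hq (Nat.zero_le _) hj fun q hq => ?_
    by_cases hr : q.robber ∈ p '' Set.Iic L
    · obtain ⟨l, hl, hr⟩ := hr
      have hshadow : p (f q.robber) = q.robber := by rw [← hr, hp.apply_path l hl]
      exact Wins.of_step (i := j) (hshadow ▸ hq.2)
    · obtain ⟨D, hDC, hrD, hbd, _, _, hD⟩ := hp.exists_isTerritory hG hsp hq.1 hr
      exact ih D hDC (fun v hv => hX v (hDC.subset hv)) hD (hp.isGuardMap hDC.subset hbd) hij.symm
        ⟨hrD, hq.2⟩

theorem wins_of_cop_at_exit [Finite V] (hG : G.Preconnected) (hsp : IsSeriesParallel G) {x : V}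
    (hij : i ≠ j) (hi : q.cops i = x) : Wins G {x} q := by
  by_cases hrx : q.robber = x
  · exact Wins.of_step (Or.inl (hi.trans hrx.symm))
  let C := componentIn G {x}ᶜ q.robber
  have hCx : C ⊆ {x}ᶜ := componentIn_subset
  have hrC : q.robber ∈ C := mem_componentIn_self hrx
  have hbd : outerBoundary G C = {x} :=
    (outerBoundary_nonempty hG hrC fun hx : x ∈ C => hCx hx rfl).subset_singleton_iff.1
      (outerBoundary_componentIn_subset.trans (compl_compl _).subset)
  have hC : IsTerritory G C x x :=
    ⟨connected_componentIn hrx, hbd.trans (Set.pair_eq_singleton x).symm, Or.inl rfl⟩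
  have hg : IsGuardMap G C fun _ => x :=
    ⟨fun v hv => (hbd ▸ hv : v ∈ ({x} : Set V)).symm, fun _ _ _ _ => Or.inl rfl⟩
  exact hC.wins hG hsp (fun v hv hvx => hCx hv (Finset.mem_singleton.1 hvx)) hg hij
    ⟨hrC, Or.inl hi⟩

theorem exitCopwin_singleton [Finite V] (hG : G.Preconnected) (hsp : IsSeriesParallel G) (x : V) :
    ExitCopwin G {x} 2 := by
  obtain ⟨σ, hσ⟩ := exists_strategy_forall_wins G {x} 2
  refine ⟨by simp, σ, fun p h₀ hp => hσ p ?_ hp⟩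
  obtain ⟨i, hi⟩ := h₀ x (Finset.mem_singleton_self x)
  obtain ⟨j, hji⟩ := exists_ne i
  exact wins_of_cop_at_exit hG hsp hji.symm hi

end Territory

end CopsRobber

theorem theorem1 {V : Type*} [Finite V] (G : SimpleGraph V) (hconn : G.Connected)
    (hsp : CopsRobber.IsSeriesParallel G) :
    (∀ x : V, CopsRobber.ExitCopwin G {x} 2) ∧
      CopsRobber.Copwin G 2 ∧ CopsRobber.copNumber G ≤ 2 := by
  have hexit := CopsRobber.exitCopwin_singleton hconn.preconnected hsp
  have hne := hconn.nonempty
  have hwin : CopsRobber.Copwin G 2 := (hexit (Classical.arbitrary V)).copwin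
  exact ⟨hexit, hwin, Nat.sInf_le ⟨one_le_two, hwin⟩⟩
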